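/- **Setting.** Fix $k\in\mathbb N$, a finite set $C$ of clocks, and let $V=[0,k]^C$ be the set of clock valuations. Two valuations are equivalent if they satisfy the same constraints of the forms $c\bowtie i$ and $c-c'\bowtie i$ with $c,c'\in C$, $i\in\{0,\dots,k\}$, ${\bowtie}\in\{<,>,=,\le,\ge\}$; the equivalence classes are the clock regions. A clock zone is a convex set of valuations that is a union of clock regions. For a finite set $L$ of locations, a zone is a set $Z\subseteq L\times V$ such that $\{\nu : (\ell,\nu)\in Z\}$ is a clock zone for every $\ell\in L$. A timed automaton has a finite set $L$ of locations, the clocks $C$, a finite set $A$ of actions, a zone $S\subseteq L\times V$ of states, zones $E(a)\subseteq S$ for $a\in A$, a transition function $\delta:L\times A\to L$, sets $\rho(a)\subseteq C$ for $a\in A$ of clocks to be reset, and a zone $F\subseteq S$ of final states. For $s=(\ell,\nu)$ write $s+t=(\ell,\nu+t)$, and $\mathrm{Succ}(s,a)=(\delta(\ell,a),\nu')$, where $\nu'$ is $\nu$ with the clocks in $\rho(a)$ set to $0$. For $a\in A$ and real $t\ge 0$ write $s\xrightarrow{(a,t)}s'$ if $s+t'\in S$ for all $t'\in[0,t]$,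 $s+t\in E(a)$ and $s'=\mathrm{Succ}(s+t,a)\in S$. It is assumed that for every $s\in S$ there are $a\in A$ and $s'$ with $s\xrightarrow{(a,0)}s'$. A reachability-time game consists of a timed automaton and a partition of $L$ into $L_{\mathrm{Min}}$ and $L_{\mathrm{Max}}$. A finite run is a sequence $s_0,\tau_1,s_1,\dots,\tau_n,s_n$ with $s_i \in S$ and $s_{i-1}\xrightarrow{\tau_i}s_i$ for $1\le i\le n$. A strategy of Min (of Max) maps every finite run to a timed action in $A\times[0,\infty)$ such that, if the run ends in a state $s$ whose location is in $L_{\mathrm{Min}}$ (in $L_{\mathrm{Max}}$), the timed action $\tau$ chosen satisfies $s\xrightarrow{\tau}s'$ for some $s'$. A strategy is positional if its choice depends only on the last state of the run. Strategies $\mu$ of Min and $\chi$ of Max determine an infinite run from each $s\in S$, in which the owner of the current location chooses the next timed action; $\mathrm{RT}(s,\mu,\chi)\in[0,\infty]$ is the sum of the delays up to the first visit to $F$ (so $0$ if $s\in F$), and $\infty$ if $F$ is never visited. The upper and lower values at $s\in S$ are $$\mathrm{Val}^*(s)=\inf_\mu\sup_\chi \mathrm{RT}(s,\mu,\chi),\qquad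 \mathrm{Val}_*(s)=\sup_\chi\inf_\mu \mathrm{RT}(s,\mu,\chi).$$ **Theorem (Positional determinacy).** Every reachability-time game is positionally determined: for every $s\in S$ we have $\mathrm{Val}_*(s)=\mathrm{Val}^*(s)=:\mathrm{Val}(s)$ and $$\mathrm{Val}(s)=\inf_{\mu\ \mathrm{positional}}\ \sup_{\chi}\ \mathrm{RT}(s,\mu,\chi)=\sup_{\chi\ \mathrm{positional}}\ \inf_{\mu}\ \mathrm{RT}(s,\mu,\chi).$$ Moreover, for every $\varepsilon>0$: Min has a positional strategy $\mu$ with $\sup_\chi \mathrm{RT}(s,\mu,\chi)\le \mathrm{Val}(s)+\varepsilon$ for all $s\in S$; and, if $C\neq\emptyset$, Max has a positional strategy $\chi$ with $\inf_\mu \mathrm{RT}(s,\mu,\chi)\ge \mathrm{Val}(s)-\varepsilon$ for all $s\in S$ (where $\infty-\varepsilon=\infty$). -/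

import Mathlib

open scoped NNReal ENNReal

namespace ReachTime

/-! ### Clock valuations, clock constraints, regions and zones -/

/-- The five comparison relations `<`, `>`, `=`, `≤`, `≥`. -/
inductive Cmp
  | lt | gt | eq | le | ge

/-- `x ⋈ y` on the reals. -/
def Cmp.Holds : Cmp → ℝ → ℝ → Prop
  | .lt, x, y => x < y
  | .gt, x, y => x > y
  | .eq, x, y => x = y
  | .le, x, y => x ≤ y
  | .ge, x, y => x ≥ y

/-- Simple clock constraints `c ⋈ i` and `c - c' ⋈ i` with `i ∈ {0, …, k}`. -/
inductive SimpleConstraint (C : Type*) (k : ℕ)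
  | clock (c : C) (r : Cmp) (i : Fin (k + 1))
  | diff (c c' : C) (r : Cmp) (i : Fin (k + 1))

/-- The simple clock constraint holds in the valuation `ν`. -/
def SimpleConstraint.Holds {C : Type*} {k : ℕ} : SimpleConstraint C k → (C → ℝ) → Prop
  | .clock c r i, ν => r.Holds (ν c) ((i : ℕ) : ℝ)
  | .diff c c' r i, ν => r.Holds (ν c - ν c') ((i : ℕ) : ℝ)

/-- The set `V` of `k`-bounded clock valuations. -/
def valuations (C : Type*) (k : ℕ) : Set (C → ℝ) :=
  {ν | ∀ c, 0 ≤ ν c ∧ ν c ≤ k}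

/-- The set `CC(ν)` of simple clock constraints that hold in `ν`. -/
def CC {C : Type*} (k : ℕ) (ν : C → ℝ) : Set (SimpleConstraint C k) :=
  {φ | φ.Holds ν}

/-- Clock regions: the classes of `k`-bounded valuations that satisfy the same
simple clock constraints. -/
def IsClockRegion {C : Type*} (k : ℕ) (P : Set (C → ℝ)) : Prop :=
  ∃ ν ∈ valuations C k, P = {ν' | ν' ∈ valuations C k ∧ CC k ν' = CC k ν}

/-- Clock zones: convex sets of valuations that are unions of clock regions. -/
def IsClockZone {C : Type*} (k : ℕ) (W : Set (C → ℝ)) : Prop :=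
  Convex ℝ W ∧ ∃ Ps : Set (Set (C → ℝ)), (∀ P ∈ Ps, IsClockRegion k P) ∧ W = ⋃₀ Ps

/-- A pair of a location and a valuation. The configurations in the strict sense are those
whose valuation is `k`-bounded; all states of an automaton are of this kind. -/
abbrev Config (L C : Type*) := L × (C → ℝ)

/-- Zones: sets of configurations all of whose location slices are clock zones. -/
def IsZone {L C : Type*} (k : ℕ) (Z : Set (Config L C)) : Prop :=
  ∀ ℓ : L, IsClockZone k {ν | (ℓ, ν) ∈ Z}

/-- `s + t`: let `t` time units pass. -/
def Config.delay {L C : Type*} (s : Config L C) (t : ℝ≥0) : Config L C :=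
  (s.1, fun c => s.2 c + t)

open Classical in
/-- `Reset(ν, C')`: set the clocks in `C'` to zero. -/
noncomputable def reset {C : Type*} (ν : C → ℝ) (C' : Set C) : C → ℝ :=
  fun c => if c ∈ C' then 0 else ν c

/-! ### Timed automata -/

/-- The data `(S, E, δ, ρ, F)` of a timed automaton with locations `L`, clocks `C`, actions `A`
and clock bound `k`. -/
structure PreTimedAutomaton (L C A : Type*) (k : ℕ) where
  /-- states -/
  S : Set (Config L C)
  /-- enabledness -/
  E : A → Set (Config L C)
  /-- transition function -/
  δ : L → A → L
  /-- clocks reset by an action -/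
  ρ : A → Set C
  /-- final states -/
  F : Set (Config L C)

namespace PreTimedAutomaton

variable {L C A : Type*} {k : ℕ} (T : PreTimedAutomaton L C A k)

/-- `Succ(s, a)` -/
noncomputable def succAct (s : Config L C) (a : A) : Config L C :=
  (T.δ s.1 a, reset s.2 (T.ρ a))

/-- `Succ(s, (a, t)) = Succ(s + t, a)` -/
noncomputable def succ (s : Config L C) (τ : A × ℝ≥0) : Config L C :=
  T.succAct (s.delay τ.2) τ.1

/-- `s →_t s'` -/
def DelayStep (s : Config L C) (t : ℝ≥0) (s' : Config L C) : Prop :=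
  s' = s.delay t ∧ s'.2 ∈ valuations C k ∧ ∀ t' : ℝ≥0, t' ≤ t → s.delay t' ∈ T.S

/-- `s →^a s'` -/
def ActStep (s : Config L C) (a : A) (s' : Config L C) : Prop :=
  s' = T.succAct s a ∧ s ∈ T.S ∧ s' ∈ T.S ∧ s ∈ T.E a

/-- `s →^τ s'` for a timed action `τ = (a, t)` -/
def Step (s : Config L C) (τ : A × ℝ≥0) (s' : Config L C) : Prop :=
  ∃ s'', T.DelayStep s τ.2 s'' ∧ T.ActStep s'' τ.1 s'

end PreTimedAutomaton

/-- Timed automata (finiteness of `L`, `C` and `A` is expressed by type classes). -/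
structure TimedAutomaton (L C A : Type*) (k : ℕ) extends PreTimedAutomaton L C A k where
  zone_S : IsZone k S
  E_subset : ∀ a, E a ⊆ S
  zone_E : ∀ a, IsZone k (E a)
  F_subset : F ⊆ S
  zone_F : IsZone k F
  /-- in every state some action can be performed immediately -/
  exists_act : ∀ s ∈ S, ∃ a s', toPreTimedAutomaton.ActStep s a s'

/-- Finite runs, indexed by the state in which they end. -/
inductive RunTo {L C A : Type*} {k : ℕ} (T : TimedAutomaton L C A k) : Config L C → Type _
  | start (s : Config L C) (hs : s ∈ T.S) : RunTo T s
  | snoc {s : Config L C} (r : RunTo T s) (τ : A × ℝ≥0) (s' : Config L C)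
      (h : T.Step s τ s') : RunTo T s'

/-- The set of finite runs. -/
abbrev FinRun {L C A : Type*} {k : ℕ} (T : TimedAutomaton L C A k) := Σ s, RunTo T s

/-- The state in which a finite run ends. -/
def FinRun.last {L C A : Type*} {k : ℕ} {T : TimedAutomaton L C A k} (r : FinRun T) :
    Config L C := r.1

theorem FinRun.last_mem {L C A : Type*} {k : ℕ} {T : TimedAutomaton L C A k} (r : FinRun T) :
    r.last ∈ T.S := by
  obtain ⟨s, r⟩ := r
  cases r with
  | start _ hs => exact hs
  | snoc r τ _ h => obtain ⟨_, _, _, _, h, _⟩ := h; exact h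

/-- Infinite runs `⟨s₀, τ₁, s₁, τ₂, …⟩`; `move i` is `τ_{i+1}`. -/
structure InfRun {L C A : Type*} {k : ℕ} (T : TimedAutomaton L C A k) where
  state : ℕ → Config L C
  move : ℕ → A × ℝ≥0
  step : ∀ i, T.Step (state i) (move i) (state (i + 1))

open Classical in
/-- Reachability time of an infinite run: the total time up to the first visit to a final state,
and `∞` if there is none. -/
noncomputable def InfRun.RT {L C A : Type*} {k : ℕ} {T : TimedAutomaton L C A k}
    (r : InfRun T) : ℝ≥0∞ :=
  if h : ∃ i, r.state i ∈ T.F then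
    ∑ i ∈ Finset.range (Nat.find h), ((r.move i).2 : ℝ≥0∞)
  else ⊤

/-! ### Reachability-time games -/

/-- A reachability-time game: a timed automaton with a partition of its locations into those of
player Min and those of player Max. -/
structure Game (L C A : Type*) (k : ℕ) where
  T : TimedAutomaton L C A k
  LMin : Set L
  LMax : Set L
  partition : IsCompl LMin LMax

namespace Game

variable {L C A : Type*} {k : ℕ} (G : Game L C A k)

/-- The states of player Min. -/
def SMin : Set (Config L C) := {s | s ∈ G.T.S ∧ s.1 ∈ G.LMin}

/-- The states of player Max. -/
def SMax : Set (Config L C) := {s | s ∈ G.T.S ∧ s ∉ G.SMin}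

/-- Strategies of player Min. -/
def MinStrategy : Type _ :=
  {μ : FinRun G.T → A × ℝ≥0 //
    ∀ r, r.last ∈ G.SMin → G.T.Step r.last (μ r) (G.T.succ r.last (μ r))}

/-- Strategies of player Max. -/
def MaxStrategy : Type _ :=
  {χ : FinRun G.T → A × ℝ≥0 //
    ∀ r, r.last ∈ G.SMax → G.T.Step r.last (χ r) (G.T.succ r.last (χ r))}

variable {G}

/-- A strategy is positional if its choice depends only on the last state of the run. -/
def MinStrategy.Positional (μ : G.MinStrategy) : Prop :=
  ∀ r r' : FinRun G.T, r.last = r'.last → μ.1 r = μ.1 r'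

/-- A strategy is positional if its choice depends only on the last state of the run. -/
def MaxStrategy.Positional (χ : G.MaxStrategy) : Prop :=
  ∀ r r' : FinRun G.T, r.last = r'.last → χ.1 r = χ.1 r'

open Classical in
/-- The timed action played after the finite run `r`. -/
noncomputable def choice (μ : G.MinStrategy) (χ : G.MaxStrategy) (r : FinRun G.T) : A × ℝ≥0 :=
  if r.last ∈ G.SMin then μ.1 r else χ.1 r

theorem choice_step (μ : G.MinStrategy) (χ : G.MaxStrategy) (r : FinRun G.T) :
    G.T.Step r.last (choice μ χ r) (G.T.succ r.last (choice μ χ r)) := by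
  unfold choice
  split_ifs with h
  · exact μ.2 r h
  · exact χ.2 r ⟨r.last_mem, h⟩

/-- `Run_i(s, μ, χ)`: the first `i` steps of the run from `s`. -/
noncomputable def prefixRun (s : G.T.S) (μ : G.MinStrategy) (χ : G.MaxStrategy) :
    ℕ → FinRun G.T
  | 0 => ⟨s.1, .start s.1 s.2⟩
  | i + 1 =>
    let r := prefixRun s μ χ i
    ⟨_, .snoc r.2 (choice μ χ r) (G.T.succ r.last (choice μ χ r)) (choice_step μ χ r)⟩

/-- `Run(s, μ, χ)` -/
noncomputable def run (s : G.T.S) (μ : G.MinStrategy) (χ : G.MaxStrategy) : InfRun G.T where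
  state i := (prefixRun s μ χ i).last
  move i := choice μ χ (prefixRun s μ χ i)
  step i := choice_step μ χ (prefixRun s μ χ i)

/-- `Val^μ(s)`: the worst case of the strategy `μ` of Min. -/
noncomputable def MinStrategy.val (μ : G.MinStrategy) (s : G.T.S) : ℝ≥0∞ :=
  ⨆ χ : G.MaxStrategy, (run s μ χ).RT

/-- `Val_χ(s)`: the worst case of the strategy `χ` of Max. -/
noncomputable def MaxStrategy.val (χ : G.MaxStrategy) (s : G.T.S) : ℝ≥0∞ :=
  ⨅ μ : G.MinStrategy, (run s μ χ).RT

variable (G)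

/-- `Val^*(s)` -/
noncomputable def upperValue (s : G.T.S) : ℝ≥0∞ :=
  ⨅ μ : G.MinStrategy, ⨆ χ : G.MaxStrategy, (run s μ χ).RT

/-- `Val_*(s)` -/
noncomputable def lowerValue (s : G.T.S) : ℝ≥0∞ :=
  ⨆ χ : G.MaxStrategy, ⨅ μ : G.MinStrategy, (run s μ χ).RT

/-- `v` is the value of the game at `s`: lower and upper value both equal `v`. -/
def HasValue (s : G.T.S) (v : ℝ≥0∞) : Prop :=
  G.lowerValue s = v ∧ G.upperValue s = v

/-- The game has a value at every state, and each player can restrict to positional strategies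
without changing it. -/
def PositionallyDetermined : Prop :=
  ∀ s : G.T.S, ∃ v : ℝ≥0∞, G.HasValue s v ∧
    v = (⨅ μ : {μ : G.MinStrategy // μ.Positional}, ⨆ χ : G.MaxStrategy, (run s μ.1 χ).RT) ∧
    v = (⨆ χ : {χ : G.MaxStrategy // χ.Positional}, ⨅ μ : G.MinStrategy, (run s μ χ.1).RT)

variable {G}

/-- `Val^μ(s) ≤ Val(s) + ε` at every state `s`. For determined games. -/
def MinStrategy.EpsOptimal (μ : G.MinStrategy) (ε : ℝ≥0) : Prop :=
  ∀ (s : G.T.S) (v : ℝ≥0∞), G.HasValue s v → μ.val s ≤ v + ε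

/-- `Val_χ(s) ≥ Val(s) - ε` at every state `s`, with the subtraction moved to the other side.
For determined games. -/
def MaxStrategy.EpsOptimal (χ : G.MaxStrategy) (ε : ℝ≥0) : Prop :=
  ∀ (s : G.T.S) (v : ℝ≥0∞), G.HasValue s v → v ≤ χ.val s + ε

end Game

end ReachTime

/-! Value iteration started from the constant `⊤` stops after finitely many rounds, and its limit is
the value. On each region every iterate is either `∞` or of the form `i - ν(c)` or `i` with an
integer `i` (`Simple`). One step of either player preserves this shape: the set of finite one-step
values is invariant under region equivalence, so its infimum or supremum can only lie at a point `i
- ν(c)` or `i` (`Saturated.isGLB_eq`, `Saturated.isLUB_eq`). At a fixed state a decreasing sequence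
of such values is eventually constant, equality of two simple functions spreads over a region, and
there are finitely many regions. Hence some iterate `V` is a fixed point of the optimality operator
on all states (`exists_horizon`).

Optimal moves need not exist, and errors made at each step could add up over runs of unbounded
length. Min therefore plays in a game where each step costs an extra `η`. Its value exceeds the
`n`-th iterate by at most `nη`; half of the surcharge pays for imprecise moves, and the other half
forces a visit to a final state (`exists_minStrategy`).

Max follows the potential `rV` with `r < 1`. If the supremum is not attained, then close to it Max
waits and moves to a state where `V` is an integer bounded away from the supremum. The error is
charged against this drop of `V`, so errors telescope (`Simple.exists_legal_mul_le`). Since finite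
values of `V` are bounded, `rV` is uniformly close to `V`. This needs a clock, which bounds delays;
without clocks Max can wait arbitrarily long in any of its states, which suffices for the value but
not for uniform `ε`-optimality. -/

namespace ReachTime

/-! ### Regions through the floors of clock differences -/

section Regions

variable {L C A : Type*} {k : ℕ}

/-- A valuation extended by a reference clock `none` that is always zero. -/
def extVal (ν : C → ℝ) : Option C → ℝ
  | none => 0
  | some c => ν c

@[simp] theorem extVal_none (ν : C → ℝ) : extVal ν none = 0 := rfl

@[simp] theorem extVal_some (ν : C → ℝ) (c : C) : extVal ν (some c) = ν c := rfl

/-- The location and the integer parts of all clock differences. Configurations with the same key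
lie in the same region. -/
noncomputable def regionKey (s : Config L C) : L × (Option C → Option C → ℤ) :=
  (s.1, fun x y => ⌊extVal s.2 x - extVal s.2 y⌋)

theorem regionKey_eq_iff {s s' : Config L C} : regionKey s = regionKey s' ↔
    s.1 = s'.1 ∧ ∀ x y, ⌊extVal s.2 x - extVal s.2 y⌋ = ⌊extVal s'.2 x - extVal s'.2 y⌋ := by
  simp [regionKey, funext_iff]

/-- The inequality compares the integer `i - j` with the floor of a clock difference, which the key
records. This lets candidate values be compared uniformly over a region. -/
theorem sub_extVal_le_iff {s s' : Config L C} (h : regionKey s = regionKey s') (i j : ℤ)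
    (x y : Option C) :
    (i : ℝ) - extVal s.2 x ≤ j - extVal s.2 y ↔ (i : ℝ) - extVal s'.2 x ≤ j - extVal s'.2 y := by
  have key : ∀ s : Config L C, (i : ℝ) - extVal s.2 x ≤ j - extVal s.2 y ↔
      i - j ≤ ⌊extVal s.2 x - extVal s.2 y⌋ := by
    intro s
    rw [Int.le_floor]
    push_cast
    constructor <;> intro h <;> linarith
  rw [key, key, (regionKey_eq_iff.1 h).2]

theorem sub_extVal_lt_iff {s s' : Config L C} (h : regionKey s = regionKey s') (i j : ℤ)
    (x y : Option C) :
    (i : ℝ) - extVal s.2 x < j - extVal s.2 y ↔ (i : ℝ) - extVal s'.2 x < j - extVal s'.2 y := by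
  rw [← not_le, ← not_le, sub_extVal_le_iff h]

theorem sub_extVal_eq_iff {s s' : Config L C} (h : regionKey s = regionKey s') (i j : ℤ)
    (x y : Option C) :
    (i : ℝ) - extVal s.2 x = j - extVal s.2 y ↔ (i : ℝ) - extVal s'.2 x = j - extVal s'.2 y := by
  rw [le_antisymm_iff, le_antisymm_iff, sub_extVal_le_iff h, sub_extVal_le_iff h]

theorem cmp_holds_congr {x y : ℝ} {i : ℕ} (h1 : ⌊x⌋ = ⌊y⌋) (h2 : ⌊-x⌋ = ⌊-y⌋) (r : Cmp) :
    r.Holds x i ↔ r.Holds y i := by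
  have hlt : ∀ z : ℝ, z < (i : ℝ) ↔ ⌊z⌋ < (i : ℤ) := fun z => by
    rw [Int.floor_lt]; simp
  have hgt : ∀ z : ℝ, (i : ℝ) < z ↔ ⌊-z⌋ < -(i : ℤ) := fun z => by
    rw [Int.floor_lt]; simp
  have a : x < i ↔ y < i := by rw [hlt, hlt, h1]
  have b : (i : ℝ) < x ↔ (i : ℝ) < y := by rw [hgt, hgt, h2]
  cases r <;> simp only [Cmp.Holds, gt_iff_lt, ge_iff_le]
  · exact a
  · exact b
  · rw [le_antisymm_iff, le_antisymm_iff, ← not_lt, ← not_lt, a, b]; simp only [not_lt]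
  · rw [← not_lt, ← not_lt, b]
  · rw [← not_lt, ← not_lt, a]

/-- The key contains every difference in both orders, hence its floor and its ceiling, and these
decide any comparison with an integer. -/
theorem CC_congr {s s' : Config L C} (h : regionKey s = regionKey s') :
    CC k s.2 = CC k s'.2 := by
  have h2 := (regionKey_eq_iff.1 h).2
  ext φ
  cases φ with
  | clock c r i =>
    refine cmp_holds_congr ?_ ?_ r
    · simpa using h2 (some c) none
    · simpa using h2 none (some c)
  | diff c c' r i =>
    refine cmp_holds_congr ?_ ?_ r
    · simpa using h2 (some c) (some c')
    · simpa using h2 (some c') (some c)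

theorem valuations_congr {s s' : Config L C} (h : regionKey s = regionKey s')
    (hs : s.2 ∈ valuations C k) : s'.2 ∈ valuations C k := by
  intro c
  have h1 := (sub_extVal_le_iff h 0 0 (some c) none).1 (by simpa using (hs c).1)
  have h2 := (sub_extVal_le_iff h 0 k none (some c)).1 (by simpa using (hs c).2)
  simpa using And.intro h1 h2

theorem IsClockZone.subset_valuations {W : Set (C → ℝ)} (hW : IsClockZone k W) :
    W ⊆ valuations C k := by
  obtain ⟨-, Ps, hP, rfl⟩ := hW
  rintro ν ⟨P, hPs, hν⟩
  obtain ⟨ν₀, -, rfl⟩ := hP P hPs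
  exact hν.1

theorem IsZone.mem_valuations {Z : Set (Config L C)} (hZ : IsZone k Z) {s : Config L C}
    (hs : s ∈ Z) : s.2 ∈ valuations C k :=
  (hZ s.1).subset_valuations hs

theorem IsZone.mem_of_regionKey_eq {Z : Set (Config L C)} (hZ : IsZone k Z) {s s' : Config L C}
    (h : regionKey s = regionKey s') (hs : s ∈ Z) : s' ∈ Z := by
  obtain ⟨-, Ps, hP, hU⟩ := hZ s.1
  have hs2 : s.2 ∈ {ν | (s.1, ν) ∈ Z} := hs
  have : s'.2 ∈ {ν | (s.1, ν) ∈ Z} := by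
    rw [hU] at hs2 ⊢
    obtain ⟨P, hPs, hν⟩ := hs2
    refine ⟨P, hPs, ?_⟩
    obtain ⟨ν₀, -, rfl⟩ := hP P hPs
    exact ⟨valuations_congr h hν.1, (CC_congr h).symm.trans hν.2⟩
  have h1 := (regionKey_eq_iff.1 h).1
  rw [h1] at this
  exact this

theorem finite_regionKey_image [Finite L] [Finite C] {Z : Set (Config L C)} (hZ : IsZone k Z) :
    (regionKey '' Z).Finite := by
  have hfin : ((Set.univ : Set L) ×ˢ (Set.univ.pi fun _ : Option C => Set.univ.pi
      fun _ : Option C => Set.Icc (-(k : ℤ)) k)).Finite :=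
    Set.finite_univ.prod (Set.Finite.pi fun _ => Set.Finite.pi fun _ => Set.finite_Icc _ _)
  refine hfin.subset ?_
  rintro _ ⟨s, hs, rfl⟩
  have hv := hZ.mem_valuations hs
  have hb : ∀ x, 0 ≤ extVal s.2 x ∧ extVal s.2 x ≤ k := by
    intro x
    cases x with
    | none => simp
    | some c => exact hv c
  refine ⟨trivial, fun x _ y _ => ⟨?_, ?_⟩⟩
  · refine Int.le_floor.2 ?_
    push_cast
    linarith [(hb x).1, (hb y).2]
  · refine Int.floor_le_iff.2 ?_
    push_cast
    linarith [(hb x).2, (hb y).1]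

/-! ### Corresponding time points in equivalent configurations -/

/-- `d` and `d'` have the same position with respect to the differences of integers and clocks. -/
def SamePos (s : Config L C) (d : ℝ) (s' : Config L C) (d' : ℝ) : Prop :=
  ∀ x, ⌊extVal s.2 x + d⌋ = ⌊extVal s'.2 x + d'⌋ ∧ ⌈extVal s.2 x + d⌉ = ⌈extVal s'.2 x + d'⌉

theorem SamePos.symm {s s' : Config L C} {d d' : ℝ} (h : SamePos s d s' d') :
    SamePos s' d' s d := fun x => ⟨(h x).1.symm, (h x).2.symm⟩

theorem SamePos.sub_int {s s' : Config L C} {d d' : ℝ} (h : SamePos s d s' d') (i : ℤ) :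
    SamePos s (d - i) s' (d' - i) := by
  intro x
  simp only [← add_sub_assoc, Int.floor_sub_intCast, Int.ceil_sub_intCast]
  exact ⟨by rw [(h x).1], by rw [(h x).2]⟩

theorem SamePos.le_iff {s s' : Config L C} {d d' : ℝ} (h : SamePos s d s' d') (i : ℤ)
    (x : Option C) : d ≤ i - extVal s.2 x ↔ d' ≤ i - extVal s'.2 x := by
  rw [le_sub_iff_add_le', le_sub_iff_add_le', ← Int.ceil_le, ← Int.ceil_le, (h x).2]

theorem SamePos.ge_iff {s s' : Config L C} {d d' : ℝ} (h : SamePos s d s' d') (i : ℤ)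
    (x : Option C) : i - extVal s.2 x ≤ d ↔ i - extVal s'.2 x ≤ d' := by
  rw [sub_le_iff_le_add', sub_le_iff_le_add', ← Int.le_floor, ← Int.le_floor, (h x).1]

theorem SamePos.eq_iff {s s' : Config L C} {d d' : ℝ} (h : SamePos s d s' d') (i : ℤ)
    (x : Option C) : d = i - extVal s.2 x ↔ d' = i - extVal s'.2 x := by
  rw [le_antisymm_iff, le_antisymm_iff, h.le_iff, h.ge_iff]

theorem SamePos.nonneg {s s' : Config L C} {d d' : ℝ} (h : SamePos s d s' d') (hd : 0 ≤ d) :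
    0 ≤ d' := by
  simpa using (h.ge_iff 0 none).1 (by simpa using hd)

/-- If some clock becomes an integer after `d`, this clock dictates `d'`. Otherwise `d` lies in an
open interval whose ends are of the form `i - extVal s.2 x`; the order of such points depends only
on the region, so the matching interval at `s'` is nonempty. -/
theorem exists_samePos [Finite C] {s s' : Config L C} (h : regionKey s = regionKey s') (d : ℝ) :
    ∃ d', SamePos s d s' d' := by
  have h2 := (regionKey_eq_iff.1 h).2
  by_cases hint : ∃ x, ∃ i : ℤ, extVal s.2 x + d = i
  · obtain ⟨x, i, hi⟩ := hint
    refine ⟨i - extVal s'.2 x, fun y => ?_⟩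
    have e1 : extVal s.2 y + d = extVal s.2 y - extVal s.2 x + i := by rw [← hi]; ring
    have e2 : extVal s'.2 y + (i - extVal s'.2 x) = extVal s'.2 y - extVal s'.2 x + i := by ring
    rw [e1, e2, Int.floor_add_intCast, Int.floor_add_intCast, Int.ceil_add_intCast,
      Int.ceil_add_intCast, h2 y x]
    refine ⟨rfl, ?_⟩
    rw [← neg_sub (extVal s.2 x), ← neg_sub (extVal s'.2 x), Int.ceil_neg, Int.ceil_neg, h2 x y]
  · push Not at hint
    have hlt : ∀ x y, (⌊extVal s.2 x + d⌋ : ℝ) - extVal s'.2 x <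
        (⌊extVal s.2 y + d⌋ + 1 : ℤ) - extVal s'.2 y := by
      intro x y
      refine (sub_extVal_lt_iff h _ _ x y).1 ?_
      have a := Int.floor_le (extVal s.2 x + d)
      have b := Int.lt_floor_add_one (extVal s.2 y + d)
      push_cast
      linarith
    obtain ⟨x₀, hx₀⟩ := Finite.exists_max fun x => (⌊extVal s.2 x + d⌋ : ℝ) - extVal s'.2 x
    obtain ⟨y₀, hy₀⟩ := Finite.exists_min fun y =>
      ((⌊extVal s.2 y + d⌋ + 1 : ℤ) : ℝ) - extVal s'.2 y
    obtain ⟨d', hd1, hd2⟩ := exists_between (hlt x₀ y₀)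
    refine ⟨d', fun x => ?_⟩
    have a := (hx₀ x).trans_lt hd1
    have b := hd2.trans_le (hy₀ x)
    push_cast at b
    have c1 := (Int.floor_le (extVal s.2 x + d)).lt_of_ne (hint x _).symm
    have c2 := Int.lt_floor_add_one (extVal s.2 x + d)
    constructor
    · symm
      rw [Int.floor_eq_iff]
      constructor <;> linarith
    · have e1 : ⌈extVal s.2 x + d⌉ = ⌊extVal s.2 x + d⌋ + 1 := by
        rw [Int.ceil_eq_iff]; push_cast; constructor <;> linarith
      have e2 : ⌈extVal s'.2 x + d'⌉ = ⌊extVal s.2 x + d⌋ + 1 := by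
        rw [Int.ceil_eq_iff]; push_cast; constructor <;> linarith
      rw [e1, e2]

theorem floor_ceil_eventually_eq {y : ℝ} (hy : ∀ i : ℤ, y ≠ i) :
    ∀ᶠ z in nhds y, ⌊z⌋ = ⌊y⌋ ∧ ⌈z⌉ = ⌈y⌉ := by
  have c1 := (Int.floor_le y).lt_of_ne (hy _).symm
  have c2 := Int.lt_floor_add_one y
  have e1 : ⌈y⌉ = ⌊y⌋ + 1 := by
    rw [Int.ceil_eq_iff]; push_cast; constructor <;> linarith
  filter_upwards [Ioo_mem_nhds c1 c2] with z hz
  rw [e1, Int.floor_eq_iff, Int.ceil_eq_iff]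
  push_cast
  exact ⟨⟨hz.1.le, hz.2⟩, by linarith [hz.1], hz.2.le⟩

theorem samePos_eventually [Finite C] {s : Config L C} {h : ℝ}
    (hh : ∀ (x : Option C) (i : ℤ), h ≠ i - extVal s.2 x) :
    ∀ᶠ d in nhds h, SamePos s d s h := by
  refine Filter.eventually_all.2 fun x => ?_
  have hy : ∀ i : ℤ, extVal s.2 x + h ≠ i := fun i e => hh x i (by linarith)
  have : Filter.Tendsto (fun d => extVal s.2 x + d) (nhds h) (nhds (extVal s.2 x + h)) :=
    (continuous_const.add continuous_id).tendsto h
  exact this.eventually (floor_ceil_eventually_eq hy)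

/-! ### Infima and suprema of region-invariant sets -/

/-- A family of sets of reals that is invariant under the region equivalence. -/
def Saturated (Z : Set (Config L C)) (D : Config L C → Set ℝ) : Prop :=
  ∀ s ∈ Z, ∀ s' d d', regionKey s = regionKey s' → SamePos s d s' d' → d ∈ D s → d' ∈ D s'

/-- Around any other point all reals have the same position, so `D s` contains a whole neighbourhood
or misses it; neither can happen at an infimum. -/
theorem Saturated.isGLB_eq [Finite C] {Z : Set (Config L C)} {D : Config L C → Set ℝ}
    (hD : Saturated Z D) {s : Config L C} (hs : s ∈ Z) (hne : (D s).Nonempty) {h : ℝ}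
    (hh : IsGLB (D s) h) : ∃ (x : Option C) (i : ℤ), h = i - extVal s.2 x := by
  by_contra! hcon
  have hev := samePos_eventually hcon
  have hmem : h ∈ D s := by
    obtain ⟨d, hd, hd2⟩ := (hh.frequently_mem hne).and_eventually
      (hev.filter_mono nhdsWithin_le_nhds) |>.exists
    exact hD s hs s d h rfl hd2 hd
  have hlt : ∀ᶠ d in nhdsWithin h (Set.Iio h), SamePos s d s h :=
    hev.filter_mono nhdsWithin_le_nhds
  obtain ⟨d, hd, hd2⟩ := (hlt.and self_mem_nhdsWithin).exists
  exact absurd (hh.1 (hD s hs s h d rfl hd.symm hmem)) (not_le.2 hd2)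

theorem Saturated.isLUB_eq [Finite C] {Z : Set (Config L C)} {D : Config L C → Set ℝ}
    (hD : Saturated Z D) {s : Config L C} (hs : s ∈ Z) (hne : (D s).Nonempty) {h : ℝ}
    (hh : IsLUB (D s) h) : ∃ (x : Option C) (i : ℤ), h = i - extVal s.2 x := by
  by_contra! hcon
  have hev := samePos_eventually hcon
  have hmem : h ∈ D s := by
    obtain ⟨d, hd, hd2⟩ := (hh.frequently_mem hne).and_eventually
      (hev.filter_mono nhdsWithin_le_nhds) |>.exists
    exact hD s hs s d h rfl hd2 hd
  have hlt : ∀ᶠ d in nhdsWithin h (Set.Ioi h), SamePos s d s h :=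
    hev.filter_mono nhdsWithin_le_nhds
  obtain ⟨d, hd, hd2⟩ := (hlt.and self_mem_nhdsWithin).exists
  exact absurd (hh.1 (hD s hs s h d rfl hd.symm hmem)) (not_le.2 hd2)

theorem Saturated.mem_lowerBounds [Finite C] {Z : Set (Config L C)} {D : Config L C → Set ℝ}
    (hD : Saturated Z D) {s s' : Config L C} (hs' : s' ∈ Z) (h : regionKey s = regionKey s')
    {x : Option C} {i : ℤ} (hi : (i - extVal s.2 x : ℝ) ∈ lowerBounds (D s)) :
    (i - extVal s'.2 x : ℝ) ∈ lowerBounds (D s') := by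
  intro d' hd'
  obtain ⟨d, hd⟩ := exists_samePos h.symm d'
  exact (hd.ge_iff i x).2 (hi (hD s' hs' s d' d h.symm hd hd'))

theorem Saturated.mem_upperBounds [Finite C] {Z : Set (Config L C)} {D : Config L C → Set ℝ}
    (hD : Saturated Z D) {s s' : Config L C} (hs' : s' ∈ Z) (h : regionKey s = regionKey s')
    {x : Option C} {i : ℤ} (hi : (i - extVal s.2 x : ℝ) ∈ upperBounds (D s)) :
    (i - extVal s'.2 x : ℝ) ∈ upperBounds (D s') := by
  intro d' hd'
  obtain ⟨d, hd⟩ := exists_samePos h.symm d'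
  exact (hd.le_iff i x).2 (hi (hD s' hs' s d' d h.symm hd hd'))

theorem Saturated.nonempty [Finite C] {Z : Set (Config L C)} {D : Config L C → Set ℝ}
    (hD : Saturated Z D) {s s' : Config L C} (hs : s ∈ Z) (h : regionKey s = regionKey s')
    (hne : (D s).Nonempty) : (D s').Nonempty := by
  obtain ⟨d, hd⟩ := hne
  obtain ⟨d', hd'⟩ := exists_samePos h d
  exact ⟨d', hD s hs s' d d' h hd' hd⟩

/-- Both infima are of the form `i - extVal`, and such expressions remain lower bounds when moved
between equivalent states. So each is at most the other. -/
theorem Saturated.isGLB_congr [Finite C] {Z : Set (Config L C)} {D : Config L C → Set ℝ}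
    (hD : Saturated Z D) {s s' : Config L C} (hs : s ∈ Z) (hs' : s' ∈ Z)
    (h : regionKey s = regionKey s') (hne : (D s).Nonempty) {x : Option C} {i : ℤ}
    (hi : IsGLB (D s) (i - extVal s.2 x)) {g : ℝ} (hg : IsGLB (D s') g) :
    g = i - extVal s'.2 x := by
  obtain ⟨y, j, rfl⟩ := hD.isGLB_eq hs' (hD.nonempty hs h hne) hg
  refine le_antisymm ?_ (hg.2 (hD.mem_lowerBounds hs' h hi.1))
  exact (sub_extVal_le_iff h _ _ _ _).1 (hi.2 (hD.mem_lowerBounds hs h.symm hg.1))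

theorem Saturated.isLUB_congr [Finite C] {Z : Set (Config L C)} {D : Config L C → Set ℝ}
    (hD : Saturated Z D) {s s' : Config L C} (hs : s ∈ Z) (hs' : s' ∈ Z)
    (h : regionKey s = regionKey s') (hne : (D s).Nonempty) {x : Option C} {i : ℤ}
    (hi : IsLUB (D s) (i - extVal s.2 x)) {g : ℝ} (hg : IsLUB (D s') g) :
    g = i - extVal s'.2 x := by
  obtain ⟨y, j, rfl⟩ := hD.isLUB_eq hs' (hD.nonempty hs h hne) hg
  refine le_antisymm (hg.2 (hD.mem_upperBounds hs' h hi.1)) ?_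
  exact (sub_extVal_le_iff h _ _ _ _).1 (hi.2 (hD.mem_upperBounds hs h.symm hg.1))

end Regions

/-! ### Legal timed actions -/

section Legal

variable {L C A : Type*} {k : ℕ}

theorem IsZone.delay_mem {Z : Set (Config L C)} (hZ : IsZone k Z) {s : Config L C} {t t' : ℝ≥0}
    (hs : s ∈ Z) (ht : s.delay t ∈ Z) (h : t' ≤ t) : s.delay t' ∈ Z := by
  have hc : Convex ℝ {ν | (s.1, ν) ∈ Z} := (hZ s.1).1
  have := hc.add_smul_mem (x := s.2) (y := fun _ => (t : ℝ)) (t := (t' / t : ℝ)) hs ht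
    ⟨by positivity, div_le_one_of_le₀ (by exact_mod_cast h) t.2⟩
  have e : s.2 + (t' / t : ℝ) • (fun _ => (t : ℝ)) = fun c => s.2 c + (t' : ℝ) := by
    funext c
    simp only [Pi.add_apply, Pi.smul_apply, smul_eq_mul, add_right_inj]
    rcases eq_or_ne t 0 with rfl | h0
    · simp [le_antisymm h bot_le]
    · field_simp
  rw [e] at this
  exact this

@[simp] theorem Config.delay_zero (s : Config L C) : s.delay 0 = s := by
  simp [Config.delay]

/-- The timed action can be performed. -/
def TimedAutomaton.Legal (T : TimedAutomaton L C A k) (s : Config L C) (τ : A × ℝ≥0) : Prop :=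
  T.Step s τ (T.succ s τ)

variable {T : TimedAutomaton L C A k}

/-- Zones are convex, so intermediate delays stay in `S` as soon as both ends do. -/
theorem TimedAutomaton.legal_iff {s : Config L C} (hs : s ∈ T.S) (τ : A × ℝ≥0) :
    T.Legal s τ ↔ s.delay τ.2 ∈ T.E τ.1 ∧ T.succ s τ ∈ T.S := by
  constructor
  · rintro ⟨_, ⟨rfl, -, -⟩, -, -, h1, h2⟩
    exact ⟨h2, h1⟩
  · rintro ⟨h1, h2⟩
    have h3 := T.E_subset _ h1
    exact ⟨_, ⟨rfl, T.zone_S.mem_valuations h3, fun t' ht' => T.zone_S.delay_mem hs h3 ht'⟩,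
      rfl, h3, h2, h1⟩

theorem TimedAutomaton.Legal.succ_mem {s : Config L C} {τ : A × ℝ≥0} (h : T.Legal s τ) :
    T.succ s τ ∈ T.S := by
  obtain ⟨_, -, -, -, h1, -⟩ := h
  exact h1

theorem TimedAutomaton.Legal.delay_mem {s : Config L C} {τ : A × ℝ≥0} (h : T.Legal s τ) :
    s.delay τ.2 ∈ T.S := by
  obtain ⟨_, ⟨rfl, -, -⟩, -, h1, -⟩ := h
  exact h1

theorem TimedAutomaton.exists_legal {s : Config L C} (hs : s ∈ T.S) :
    ∃ a, T.Legal s (a, 0) := by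
  obtain ⟨a, _, rfl, h1, h2, h3⟩ := T.exists_act s hs
  exact ⟨a, (TimedAutomaton.legal_iff hs _).2 ⟨by simpa using h3, by
    simpa [PreTimedAutomaton.succ] using h2⟩⟩

theorem SamePos.regionKey_delay {s s' : Config L C} (h : regionKey s = regionKey s')
    {t t' : ℝ≥0} (ht : SamePos s t s' t') : regionKey (s.delay t) = regionKey (s'.delay t') := by
  obtain ⟨h1, h2⟩ := regionKey_eq_iff.1 h
  refine regionKey_eq_iff.2 ⟨h1, fun x y => ?_⟩
  cases x with
  | none =>
    cases y with
    | none => simp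
    | some c =>
      have := (ht (some c)).2
      simp only [extVal_some] at this
      simp only [Config.delay, extVal_none, extVal_some, zero_sub, Int.floor_neg, this]
  | some c =>
    cases y with
    | none => simpa [Config.delay] using (ht (some c)).1
    | some c' => simpa [Config.delay] using h2 (some c) (some c')

open Classical in
/-- The effect of a reset on the names of clocks: reset clocks are identified with the reference
clock. -/
noncomputable def resetName (C' : Set C) : Option C → Option C
  | none => none
  | some c => if c ∈ C' then none else some c

theorem extVal_reset (ν : C → ℝ) (C' : Set C) (x : Option C) :
    extVal (reset ν C') x = extVal ν (resetName C' x) := by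
  cases x with
  | none => rfl
  | some c => by_cases h : c ∈ C' <;> simp [reset, resetName, h]

theorem PreTimedAutomaton.regionKey_succAct (T : PreTimedAutomaton L C A k) {s s' : Config L C}
    (h : regionKey s = regionKey s') (a : A) :
    regionKey (T.succAct s a) = regionKey (T.succAct s' a) := by
  obtain ⟨h1, h2⟩ := regionKey_eq_iff.1 h
  refine regionKey_eq_iff.2 ⟨by simp [succAct, h1], fun x y => ?_⟩
  simp only [succAct, extVal_reset]
  exact h2 _ _

theorem SamePos.regionKey_succ {s s' : Config L C} (h : regionKey s = regionKey s')
    {t t' : ℝ≥0} (ht : SamePos s t s' t') (a : A) :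
    regionKey (T.succ s (a, t)) = regionKey (T.succ s' (a, t')) :=
  T.regionKey_succAct (ht.regionKey_delay h) a

theorem SamePos.legal {s s' : Config L C} (hs : s ∈ T.S) (h : regionKey s = regionKey s')
    {t t' : ℝ≥0} (ht : SamePos s t s' t') {a : A} (hl : T.Legal s (a, t)) :
    T.Legal s' (a, t') := by
  rw [TimedAutomaton.legal_iff hs] at hl
  rw [TimedAutomaton.legal_iff (T.zone_S.mem_of_regionKey_eq h hs)]
  exact ⟨(T.zone_E a).mem_of_regionKey_eq (ht.regionKey_delay h) hl.1,
    T.zone_S.mem_of_regionKey_eq (ht.regionKey_succ h a) hl.2⟩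

theorem exists_samePos_nnreal [Finite C] {s s' : Config L C} (h : regionKey s = regionKey s')
    (t : ℝ≥0) : ∃ t' : ℝ≥0, SamePos s t s' t' := by
  obtain ⟨d, hd⟩ := exists_samePos h t
  exact ⟨⟨d, hd.nonneg t.2⟩, hd⟩

end Legal

/-! ### Region-wise simple functions -/

section Simple

variable {L C A : Type*} {k : ℕ} (T : TimedAutomaton L C A k)

/-- On every region, the function is either constantly `∞` or of the form `i - ν(c)` or `i` with
an integer `i`. -/
def Simple (f : Config L C → ℝ≥0∞) : Prop :=
  ∀ s ∈ T.S, (∀ s', regionKey s = regionKey s' → f s' = ⊤) ∨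
    ∃ (x : Option C) (i : ℤ), ∀ s', regionKey s = regionKey s' →
      f s' ≠ ⊤ ∧ (f s').toReal = i - extVal s'.2 x

/-- The finite values `t + f(s')` that can be achieved with one timed action. -/
def stepValues (f : Config L C → ℝ≥0∞) (s : Config L C) : Set ℝ :=
  {d | ∃ τ, T.Legal s τ ∧ f (T.succ s τ) ≠ ⊤ ∧ d = τ.2 + (f (T.succ s τ)).toReal}

variable {T} {f : Config L C → ℝ≥0∞}

theorem stepValues_nonneg {s : Config L C} {d : ℝ} (hd : d ∈ stepValues T f s) : 0 ≤ d := by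
  obtain ⟨τ, -, -, rfl⟩ := hd
  positivity

/-- After a timed action, a clock is either zero or the sum of a clock and the delay. -/
theorem extVal_succ_cases (a : A) (x : Option C) :
    (∀ s' t', extVal (T.succ s' (a, t')).2 x = 0) ∨
      ∃ c, ∀ s' t', extVal (T.succ s' (a, t')).2 x = s'.2 c + t' := by
  simp only [PreTimedAutomaton.succ, PreTimedAutomaton.succAct, extVal_reset]
  cases resetName (T.ρ a) x with
  | none => left; intros; rfl
  | some c => right; exact ⟨c, fun _ _ => rfl⟩

/-- If the clock in the formula for `f` is zero after the move, the total is `t + i`, and the delay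
can be shifted along with `d`. Otherwise the delay cancels and the total is `i - ν(c)`; then any
corresponding delay works, because `d'` is forced. -/
theorem Simple.saturated_stepValues [Finite C] (hf : Simple T f) :
    Saturated T.S (stepValues T f) := by
  rintro s hs s' d d' h hd ⟨⟨a, t⟩, hl, hfin, hdt⟩
  rcases hf _ hl.succ_mem with htop | ⟨x, i, hi⟩
  · exact absurd (htop _ rfl) hfin
  rcases extVal_succ_cases (T := T) a x with h0 | ⟨c, hc⟩
  · have e : d - i = t := by rw [hdt, (hi _ rfl).2, h0 s t]; ring
    have hd1 := hd.sub_int i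
    rw [e] at hd1
    have hn := hd1.nonneg t.2
    lift d' - i to ℝ≥0 using hn with t' ht'
    refine ⟨(a, t'), hd1.legal hs h hl, (hi _ (hd1.regionKey_succ h a)).1, ?_⟩
    rw [(hi _ (hd1.regionKey_succ h a)).2, h0 s' t', ht']
    ring
  · obtain ⟨t', ht'⟩ := exists_samePos_nnreal h t
    refine ⟨(a, t'), ht'.legal hs h hl, (hi _ (ht'.regionKey_succ h a)).1, ?_⟩
    rw [(hi _ (ht'.regionKey_succ h a)).2, hc s' t']
    have e : d = i - extVal s.2 (some c) := by
      rw [hdt, (hi _ rfl).2, hc s t, extVal_some]; ring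
    rw [(hd.eq_iff i (some c)).1 e, extVal_some]
    ring

theorem Simple.succ_eq_top_congr (hf : Simple T f) {s s' : Config L C}
    (h : regionKey s = regionKey s') {t t' : ℝ≥0} (ht : SamePos s t s' t') {a : A}
    (hl : T.Legal s (a, t)) (htop : f (T.succ s (a, t)) = ⊤) : f (T.succ s' (a, t')) = ⊤ := by
  rcases hf _ hl.succ_mem with htop' | ⟨x, i, hi⟩
  · exact htop' _ (ht.regionKey_succ h a)
  · exact absurd htop (hi _ rfl).1

/-! ### One-step infima and suprema -/

/-- One step of Min. -/
noncomputable def infStep (T : TimedAutomaton L C A k) (f : Config L C → ℝ≥0∞)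
    (s : Config L C) : ℝ≥0∞ :=
  ⨅ τ : {τ // T.Legal s τ}, (τ.1.2 + f (T.succ s τ.1))

/-- One step of Max. -/
noncomputable def supStep (T : TimedAutomaton L C A k) (f : Config L C → ℝ≥0∞)
    (s : Config L C) : ℝ≥0∞ :=
  ⨆ τ : {τ // T.Legal s τ}, (τ.1.2 + f (T.succ s τ.1))

theorem toReal_delay_add {a : ℝ≥0} {b : ℝ≥0∞} (hb : b ≠ ⊤) :
    ((a : ℝ≥0∞) + b).toReal = a + b.toReal := by
  rw [ENNReal.toReal_add ENNReal.coe_ne_top hb]; rfl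

theorem infStep_eq_top_iff (s : Config L C) :
    infStep T f s = ⊤ ↔ stepValues T f s = ∅ := by
  simp only [infStep, iInf_eq_top, Set.eq_empty_iff_forall_notMem, Subtype.forall]
  constructor
  · rintro h d ⟨τ, hl, hfin, -⟩
    have := h τ hl
    simp [hfin] at this
  · intro h τ hl
    by_contra hne
    have : f (T.succ s τ) ≠ ⊤ := fun e => hne (by simp [e])
    exact h _ ⟨τ, hl, this, rfl⟩

theorem isGLB_infStep {s : Config L C} (h : infStep T f s ≠ ⊤) :
    IsGLB (stepValues T f s) (infStep T f s).toReal := by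
  constructor
  · rintro d ⟨τ, hl, hfin, rfl⟩
    rw [← toReal_delay_add hfin]
    exact ENNReal.toReal_mono (by simp [hfin]) (iInf_le (fun τ : {τ // T.Legal s τ} =>
      ((τ.1.2 : ℝ≥0∞) + f (T.succ s τ.1))) ⟨τ, hl⟩)
  · intro b hb
    rw [← ENNReal.ofReal_le_iff_le_toReal h]
    refine le_iInf fun τ => ?_
    by_cases hfin : f (T.succ s τ.1) = ⊤
    · simp [hfin]
    · rw [ENNReal.ofReal_le_iff_le_toReal (by simp [hfin]), toReal_delay_add hfin]
      exact hb ⟨τ.1, τ.2, hfin, rfl⟩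

theorem supStep_le_of_upperBound {s : Config L C}
    (hfin : ∀ τ, T.Legal s τ → f (T.succ s τ) ≠ ⊤) {b : ℝ}
    (hb : b ∈ upperBounds (stepValues T f s)) :
    supStep T f s ≤ ENNReal.ofReal b := by
  refine iSup_le fun τ => ?_
  have hτ := hfin _ τ.2
  rw [ENNReal.le_ofReal_iff_toReal_le (by simp [hτ]) ?_, toReal_delay_add hτ]
  · exact hb ⟨τ.1, τ.2, hτ, rfl⟩
  · exact (stepValues_nonneg ⟨τ.1, τ.2, hτ, rfl⟩).trans (hb ⟨τ.1, τ.2, hτ, rfl⟩)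

theorem le_supStep {s : Config L C} {τ : A × ℝ≥0} (hl : T.Legal s τ) :
    (τ.2 : ℝ≥0∞) + f (T.succ s τ) ≤ supStep T f s :=
  le_iSup (fun τ : {τ // T.Legal s τ} => ((τ.1.2 : ℝ≥0∞) + f (T.succ s τ.1))) ⟨τ, hl⟩

theorem infStep_le {s : Config L C} {τ : A × ℝ≥0} (hl : T.Legal s τ) :
    infStep T f s ≤ τ.2 + f (T.succ s τ) :=
  iInf_le (fun τ : {τ // T.Legal s τ} => ((τ.1.2 : ℝ≥0∞) + f (T.succ s τ.1))) ⟨τ, hl⟩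

theorem succ_ne_top_of_supStep_ne_top {s : Config L C} (h : supStep T f s ≠ ⊤) {τ : A × ℝ≥0}
    (hl : T.Legal s τ) : f (T.succ s τ) ≠ ⊤ := by
  intro e
  have := le_supStep (f := f) hl
  rw [e, add_top, top_le_iff] at this
  exact h this

theorem isLUB_supStep {s : Config L C} (hs : s ∈ T.S) (h : supStep T f s ≠ ⊤) :
    IsLUB (stepValues T f s) (supStep T f s).toReal := by
  constructor
  · rintro d ⟨τ, hl, hfin, rfl⟩
    rw [← toReal_delay_add hfin]
    exact ENNReal.toReal_mono h (le_supStep hl)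
  · intro b hb
    have hfin := fun τ (hl : T.Legal s τ) => succ_ne_top_of_supStep_ne_top h hl
    refine ENNReal.toReal_le_of_le_ofReal ?_ (supStep_le_of_upperBound hfin hb)
    obtain ⟨a, ha⟩ := TimedAutomaton.exists_legal hs
    have hm : _ ∈ stepValues T f s := ⟨_, ha, hfin _ ha, rfl⟩
    exact (stepValues_nonneg hm).trans (hb hm)

theorem stepValues_nonempty {s : Config L C} (hs : s ∈ T.S) (h : supStep T f s ≠ ⊤) :
    (stepValues T f s).Nonempty := by
  obtain ⟨a, ha⟩ := TimedAutomaton.exists_legal hs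
  exact ⟨_, _, ha, succ_ne_top_of_supStep_ne_top h ha, rfl⟩

theorem Simple.infStep_cases [Finite C] (hf : Simple T f) {s : Config L C} (hs : s ∈ T.S) :
    (∀ s', regionKey s = regionKey s' → infStep T f s' = ⊤) ∨
    ∃ (x : Option C) (i : ℤ), ∀ s', regionKey s = regionKey s' →
      infStep T f s' ≠ ⊤ ∧ (infStep T f s').toReal = i - extVal s'.2 x := by
  have hsat := hf.saturated_stepValues
  by_cases htop : infStep T f s = ⊤
  · left
    intro s' h
    rw [infStep_eq_top_iff, ← Set.not_nonempty_iff_eq_empty] at htop ⊢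
    exact fun hne => htop (hsat.nonempty (T.zone_S.mem_of_regionKey_eq h hs) h.symm hne)
  · right
    have hne : (stepValues T f s).Nonempty := by
      rwa [Set.nonempty_iff_ne_empty, ne_eq, ← infStep_eq_top_iff]
    have hg := isGLB_infStep htop
    obtain ⟨x, i, hi⟩ := hsat.isGLB_eq hs hne hg
    rw [hi] at hg
    refine ⟨x, i, fun s' h => ?_⟩
    have htop' : infStep T f s' ≠ ⊤ := by
      rw [ne_eq, infStep_eq_top_iff, ← ne_eq, ← Set.nonempty_iff_ne_empty]
      exact hsat.nonempty hs h hne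
    exact ⟨htop', hsat.isGLB_congr hs (T.zone_S.mem_of_regionKey_eq h hs) h hne hg
      (isGLB_infStep htop')⟩

/-- A finite supremum is some `i - extVal s.2 x`, and the same expression at `s'` bounds all step
values there. Successors of value `∞` are excluded by moving them back to `s`. -/
theorem Simple.supStep_ne_top [Finite C] (hf : Simple T f) {s s' : Config L C} (hs : s ∈ T.S)
    (h : regionKey s = regionKey s') (htop : supStep T f s ≠ ⊤) : supStep T f s' ≠ ⊤ := by
  have hs' := T.zone_S.mem_of_regionKey_eq h hs
  have hfin : ∀ τ, T.Legal s' τ → f (T.succ s' τ) ≠ ⊤ := by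
    rintro ⟨a, t'⟩ hl e
    obtain ⟨t, ht⟩ := exists_samePos_nnreal h.symm t'
    exact succ_ne_top_of_supStep_ne_top htop (ht.legal hs' h.symm hl)
      (hf.succ_eq_top_congr h.symm ht hl e)
  obtain ⟨x, i, hi⟩ := hf.saturated_stepValues.isLUB_eq hs (stepValues_nonempty hs htop)
    (isLUB_supStep hs htop)
  have hub := (isLUB_supStep hs htop).1
  rw [hi] at hub
  exact ne_top_of_le_ne_top ENNReal.ofReal_ne_top
    (supStep_le_of_upperBound hfin (hf.saturated_stepValues.mem_upperBounds hs' h hub))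

theorem Simple.supStep_cases [Finite C] (hf : Simple T f) {s : Config L C} (hs : s ∈ T.S) :
    (∀ s', regionKey s = regionKey s' → supStep T f s' = ⊤) ∨
    ∃ (x : Option C) (i : ℤ), ∀ s', regionKey s = regionKey s' →
      supStep T f s' ≠ ⊤ ∧ (supStep T f s').toReal = i - extVal s'.2 x := by
  have hsat := hf.saturated_stepValues
  by_cases htop : supStep T f s = ⊤
  · left
    intro s' h
    by_contra hne
    exact hf.supStep_ne_top (T.zone_S.mem_of_regionKey_eq h hs) h.symm hne htop
  · right
    have hne := stepValues_nonempty hs htop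
    have hg := isLUB_supStep hs htop
    obtain ⟨x, i, hi⟩ := hsat.isLUB_eq hs hne hg
    rw [hi] at hg
    refine ⟨x, i, fun s' h => ?_⟩
    have htop' := hf.supStep_ne_top hs h htop
    have hs' := T.zone_S.mem_of_regionKey_eq h hs
    exact ⟨htop', hsat.isLUB_congr hs hs' h hne hg (isLUB_supStep hs' htop')⟩

theorem Simple.congr_eq {f g : Config L C → ℝ≥0∞} (hf : Simple T f) (hg : Simple T g)
    {s s' : Config L C} (hs : s ∈ T.S) (h : regionKey s = regionKey s') (e : f s = g s) :
    f s' = g s' := by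
  rcases hf s hs with h1 | ⟨x, i, hi⟩ <;> rcases hg s hs with h2 | ⟨y, j, hj⟩
  · rw [h1 s' h, h2 s' h]
  · exact absurd (e ▸ h1 s rfl) (hj s rfl).1
  · exact absurd (e ▸ h2 s rfl) (hi s rfl).1
  · rw [← ENNReal.toReal_eq_toReal_iff' (hi s' h).1 (hj s' h).1, (hi s' h).2, (hj s' h).2,
      ← sub_extVal_eq_iff h, ← (hi s rfl).2, ← (hj s rfl).2, e]

theorem extVal_mem {Z : Set (Config L C)} (hZ : IsZone k Z) {s : Config L C} (hs : s ∈ Z)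
    (x : Option C) : 0 ≤ extVal s.2 x ∧ extVal s.2 x ≤ k := by
  cases x with
  | none => simp
  | some c => exact hZ.mem_valuations hs c

theorem Simple.exists_bound [Finite L] [Finite C] (hf : Simple T f) :
    ∃ M : ℝ≥0, ∀ s ∈ T.S, f s ≠ ⊤ → f s ≤ M := by
  have : ∀ q : L × (Option C → Option C → ℤ), ∃ M : ℝ≥0, ∀ s ∈ T.S, regionKey s = q →
      f s ≠ ⊤ → f s ≤ M := by
    intro q
    by_cases hq : ∃ s ∈ T.S, regionKey s = q ∧ f s ≠ ⊤
    · obtain ⟨s, hs, rfl, hfin⟩ := hq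
      rcases hf s hs with h1 | ⟨x, i, hi⟩
      · exact absurd (h1 s rfl) hfin
      · refine ⟨Real.toNNReal i, fun s' hs' h _ => ?_⟩
        have h3 := hi s' h.symm
        rw [← ENNReal.ofReal_toReal h3.1, h3.2]
        exact ENNReal.ofReal_le_ofReal (by linarith [(extVal_mem T.zone_S hs' x).1])
    · push Not at hq
      exact ⟨0, fun s hs h hfin => absurd (hq s hs h) hfin⟩
  choose M hM using this
  obtain ⟨B, hB⟩ := ((finite_regionKey_image T.zone_S).image M).bddAbove
  refine ⟨B, fun s hs hfin => (hM _ s hs rfl hfin).trans ?_⟩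
  exact_mod_cast hB ⟨_, ⟨s, hs, rfl⟩, rfl⟩

/-- A decreasing sequence of simple functions becomes stationary. -/
theorem exists_stationary [Finite L] [Finite C] {F : ℕ → Config L C → ℝ≥0∞} (hF : Antitone F)
    (hS : ∀ n, Simple T (F n)) : ∃ N, ∀ m, N ≤ m → ∀ s ∈ T.S, F m s = F N s := by
  have hpt : ∀ s ∈ T.S, ∃ n, ∀ m, n ≤ m → F m s = F n s := by
    intro s hs
    have hanti : Antitone fun n => F n s := fun m n h => hF h s
    by_cases htop : ∀ n, F n s = ⊤
    · exact ⟨0, fun m _ => by rw [htop, htop]⟩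
    push Not at htop
    obtain ⟨n₀, hn₀⟩ := htop
    obtain ⟨B, hB⟩ := exists_nat_ge ((F n₀ s).toReal + k)
    -- Once finite, the values are `i - extVal s.2 x` with `0 ≤ i ≤ B`, as clocks lie in `[0, k]`.
    -- So only finitely many occur and the minimum is attained.
    have hfin : ((fun m => F m s) '' Set.Ici n₀).Finite := by
      refine Set.Finite.subset ((Set.finite_univ (α := Option C)).prod
        (Set.finite_Icc (0 : ℤ) B) |>.image
        fun p => ENNReal.ofReal ((p.2 : ℝ) - extVal s.2 p.1)) ?_
      rintro _ ⟨m, hm, rfl⟩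
      have hle : F m s ≤ F n₀ s := hanti hm
      have hmt : F m s ≠ ⊤ := ne_top_of_le_ne_top hn₀ hle
      rcases hS m s hs with h1 | ⟨x, i, hi⟩
      · exact absurd (h1 s rfl) hmt
      have e := (hi s rfl).2
      have hx := extVal_mem T.zone_S hs x
      have h0 : 0 ≤ (F m s).toReal := ENNReal.toReal_nonneg
      have h1 : (F m s).toReal ≤ (F n₀ s).toReal := ENNReal.toReal_mono hn₀ hle
      refine ⟨(x, i), ⟨trivial, ?_, ?_⟩, ?_⟩
      · have : (0 : ℝ) ≤ i := by linarith
        exact_mod_cast this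
      · have : (i : ℝ) ≤ B := by linarith
        exact_mod_cast this
      · simp only [← e, ENNReal.ofReal_toReal hmt]
    obtain ⟨_, ⟨n, hn, rfl⟩, hmin⟩ := Set.exists_min_image _ id hfin ⟨_, n₀, Set.self_mem_Ici, rfl⟩
    exact ⟨n, fun m hm => le_antisymm (hanti hm)
      (hmin _ ⟨m, (Set.mem_Ici.1 hn).trans hm, rfl⟩)⟩
  have hq : ∀ q : L × (Option C → Option C → ℤ), ∃ n, ∀ s ∈ T.S, regionKey s = q →
      ∀ m, n ≤ m → F m s = F n s := by
    intro q
    by_cases hq : ∃ s ∈ T.S, regionKey s = q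
    · obtain ⟨s, hs, rfl⟩ := hq
      obtain ⟨n, hn⟩ := hpt s hs
      -- One representative of the region suffices, since equality of simple functions spreads from
      -- it.
      exact ⟨n, fun s' _ h m hm => (hS m).congr_eq (hS n) hs h.symm (hn m hm)⟩
    · push Not at hq
      exact ⟨0, fun s hs h => absurd h (hq s hs)⟩
  choose n hn using hq
  obtain ⟨N, hN⟩ := ((finite_regionKey_image T.zone_S).image n).bddAbove
  refine ⟨N, fun m hm s hs => ?_⟩
  have hle : n (regionKey s) ≤ N := hN ⟨_, ⟨s, hs, rfl⟩, rfl⟩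
  rw [hn _ s hs rfl m (hle.trans hm), hn _ s hs rfl N hle]

end Simple

/-! ### Near-optimal timed actions of Max -/

section MaxStep

variable {L C A : Type*} {k : ℕ} {T : TimedAutomaton L C A k} {f : Config L C → ℝ≥0∞}

/-- For each of the finitely many `x`, the points `i - extVal s.2 x` are spaced by one, so they
cannot accumulate at `v` from below. -/
theorem eventually_ne_sub_extVal [Finite C] (s : Config L C) (v : ℝ) :
    ∀ᶠ d in nhds v, d < v → ∀ (x : Option C) (i : ℤ), d ≠ i - extVal s.2 x := by
  have : ∀ᶠ d in nhds v, ∀ x : Option C, (⌈extVal s.2 x + v⌉ : ℝ) - 1 - extVal s.2 x < d := by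
    refine Filter.eventually_all.2 fun x => lt_mem_nhds ?_
    linarith [Int.ceil_lt_add_one (extVal s.2 x + v)]
  filter_upwards [this] with d hd hlt x i e
  have h1 := hd x
  have h2 := Int.le_ceil (extVal s.2 x + v)
  have h3 : ⌈extVal s.2 x + v⌉ - 1 < i := by
    have : (⌈extVal s.2 x + v⌉ : ℝ) - 1 < i := by linarith
    exact_mod_cast this
  have h4 : i < ⌈extVal s.2 x + v⌉ := by
    have : (i : ℝ) < ⌈extVal s.2 x + v⌉ := by linarith
    exact_mod_cast this
  omega

/-- The discount `r = 1 - δ` leaves a slack of `δ` times the drop of `f`, which makes up for a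
supremum that is not attained. -/
theorem Simple.exists_legal_mul_le [Finite C] (hf : Simple T f) {s : Config L C} (hs : s ∈ T.S)
    (htop : supStep T f s ≠ ⊤) {r δ : ℝ≥0} (hr : r + δ = 1) (hδ : 0 < δ) :
    ∃ τ, T.Legal s τ ∧ r * supStep T f s ≤ τ.2 + r * f (T.succ s τ) := by
  have hrδ : (r : ℝ) + δ = 1 := by exact_mod_cast hr
  have hr1 : (r : ℝ) = 1 - δ := by linarith
  have hr0 : (0 : ℝ) ≤ r := r.2
  have hδ0 : (0 : ℝ) < δ := hδ
  suffices h : ∃ τ, T.Legal s τ ∧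
      r * (supStep T f s).toReal ≤ τ.2 + r * (f (T.succ s τ)).toReal by
    obtain ⟨τ, hl, hτ⟩ := h
    have hfin := succ_ne_top_of_supStep_ne_top htop hl
    refine ⟨τ, hl, ?_⟩
    have h1 : (r : ℝ≥0∞) * f (T.succ s τ) ≠ ⊤ := ENNReal.mul_ne_top ENNReal.coe_ne_top hfin
    rw [← ENNReal.toReal_le_toReal (ENNReal.mul_ne_top ENNReal.coe_ne_top htop) (by simp [h1]),
      toReal_delay_add h1]
    simpa using hτ
  have hlub := isLUB_supStep hs htop
  set v := (supStep T f s).toReal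
  by_cases hv : v ∈ stepValues T f s
  · obtain ⟨τ, hl, -, e⟩ := hv
    refine ⟨τ, hl, ?_⟩
    rw [e]
    have : (0 : ℝ) ≤ τ.2 := τ.2.2
    nlinarith
  -- The largest integer below `v` is `⌈v⌉ - 1`, so `v - (⌈v⌉ - 1)` is the least drop possible when
  -- the successor has an integer value below `v`.
  · have hγ : v - δ * (v - (⌈v⌉ - 1)) < v := by
      have := Int.ceil_lt_add_one v
      have : 0 < (δ : ℝ) * (v - (⌈v⌉ - 1)) := mul_pos hδ0 (by linarith)
      linarith
    obtain ⟨d, hd, ⟨hd1, hd2⟩, hd3⟩ :=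
      ((hlub.frequently_mem (stepValues_nonempty hs htop)).and_eventually
      ((((eventually_ne_sub_extVal s v).and (lt_mem_nhds hγ)).filter_mono
        nhdsWithin_le_nhds).and self_mem_nhdsWithin)).exists
    have hdv : d < v := lt_of_le_of_ne hd3 fun e => hv (e ▸ hd)
    obtain ⟨⟨a, t⟩, hl, hfin, e⟩ := hd
    refine ⟨_, hl, ?_⟩
    rcases hf _ hl.succ_mem with h1 | ⟨x, i, hi⟩
    · exact absurd (h1 _ rfl) hfin
    have e2 := (hi _ rfl).2
    rcases extVal_succ_cases (T := T) a x with h0 | ⟨c, hc⟩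
    · rw [h0 s t, sub_zero] at e2
      rw [e2] at e ⊢
      have ht : (0 : ℝ) ≤ t := t.2
      have hi : i ≤ ⌈v⌉ - 1 := by
        have h3 : (i : ℝ) < ⌈v⌉ := by
          have := Int.le_ceil v
          simp only at e
          linarith
        have : i < ⌈v⌉ := by exact_mod_cast h3
        omega
      have hi' : (i : ℝ) ≤ ⌈v⌉ - 1 := by exact_mod_cast hi
      have h4 : δ * (v - (⌈v⌉ - 1)) ≤ δ * (v - i) :=
        mul_le_mul_of_nonneg_left (by linarith) hδ0.le
      simp only at e ⊢
      rw [hr1]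
      linarith
    -- Here the delay cancels, so `d` would be one of the points that were avoided.
    · refine absurd ?_ (hd1 hdv (some c) i)
      rw [e, e2, hc s t, extVal_some]
      ring

theorem TimedAutomaton.Legal.delay_le [Nonempty C] {s : Config L C} (hs : s ∈ T.S)
    {τ : A × ℝ≥0} (hl : T.Legal s τ) : τ.2 ≤ k := by
  obtain ⟨c⟩ := ‹Nonempty C›
  have h1 := (T.zone_S.mem_valuations hl.delay_mem c).2
  have h2 := (T.zone_S.mem_valuations hs c).1
  have : (τ.2 : ℝ) ≤ k := by
    simp only [Config.delay] at h1
    linarith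
  exact_mod_cast this

/-- Delays are at most `k` and finite values of `f` are bounded, so an infinite supremum cannot come
from finite terms alone. -/
theorem Simple.exists_legal_eq_top [Finite L] [Finite C] [Nonempty C] (hf : Simple T f)
    {s : Config L C} (hs : s ∈ T.S) (htop : supStep T f s = ⊤) :
    ∃ τ, T.Legal s τ ∧ f (T.succ s τ) = ⊤ := by
  by_contra! hcon
  obtain ⟨M, hM⟩ := hf.exists_bound
  have : supStep T f s ≤ (k : ℝ≥0∞) + M := iSup_le fun τ =>
    add_le_add (by exact_mod_cast τ.2.delay_le hs) (hM _ τ.2.succ_mem (hcon _ τ.2))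
  rw [htop, top_le_iff] at this
  simp at this

theorem delay_eq_self [IsEmpty C] (s : Config L C) (t : ℝ≥0) : s.delay t = s :=
  Prod.ext rfl (Subsingleton.elim _ _)

theorem exists_legal_of_isEmpty [IsEmpty C] {s : Config L C} (hs : s ∈ T.S) (t : ℝ≥0) :
    ∃ a, T.Legal s (a, t) := by
  obtain ⟨a, ha⟩ := TimedAutomaton.exists_legal hs
  refine ⟨a, ?_⟩
  rw [TimedAutomaton.legal_iff hs] at ha ⊢
  simpa [PreTimedAutomaton.succ, delay_eq_self] using ha

end MaxStep

/-! ### The optimality operator -/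

namespace Game

variable {L C A : Type*} {k : ℕ} (G : Game L C A k)

open Classical in
/-- The optimality operator. -/
noncomputable def bellman (f : Config L C → ℝ≥0∞) (s : Config L C) : ℝ≥0∞ :=
  if s ∈ G.T.F then 0 else if s.1 ∈ G.LMin then infStep G.T f s else supStep G.T f s

theorem bellman_mono : Monotone G.bellman := by
  intro f g h s
  unfold bellman
  split_ifs
  · exact le_rfl
  · exact iInf_mono fun τ => add_le_add_right (h _) _
  · exact iSup_mono fun τ => add_le_add_right (h _) _

theorem bellman_add_const_le (f : Config L C → ℝ≥0∞) (c : ℝ≥0∞) (s : Config L C) :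
    G.bellman (fun s => f s + c) s ≤ G.bellman f s + c := by
  unfold bellman
  split_ifs
  · simp
  · simp only [infStep, ENNReal.iInf_add, add_assoc, le_refl]
  · refine iSup_le fun τ => ?_
    rw [← add_assoc]
    exact add_le_add_left (le_supStep τ.2) _

theorem bellman_simple [Finite C] {f : Config L C → ℝ≥0∞} (hf : Simple G.T f) :
    Simple G.T (G.bellman f) := by
  intro s hs
  by_cases hF : s ∈ G.T.F
  · refine Or.inr ⟨none, 0, fun s' h => ?_⟩
    have hF' := G.T.zone_F.mem_of_regionKey_eq h hF
    simp [bellman, hF']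
  · have hF' : ∀ s', regionKey s = regionKey s' → s' ∉ G.T.F := fun s' h h' =>
      hF (G.T.zone_F.mem_of_regionKey_eq h.symm h')
    by_cases hm : s.1 ∈ G.LMin
    · have e : ∀ s', regionKey s = regionKey s' → G.bellman f s' = infStep G.T f s' := by
        intro s' h
        rw [(regionKey_eq_iff.1 h).1] at hm
        simp [bellman, hF' s' h, hm]
      exact (hf.infStep_cases hs).imp (fun h s' hs' => (e s' hs').trans (h s' hs'))
        fun ⟨x, i, h⟩ => ⟨x, i, fun s' hs' => by rw [e s' hs']; exact h s' hs'⟩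
    · have e : ∀ s', regionKey s = regionKey s' → G.bellman f s' = supStep G.T f s' := by
        intro s' h
        rw [(regionKey_eq_iff.1 h).1] at hm
        simp [bellman, hF' s' h, hm]
      exact (hf.supStep_cases hs).imp (fun h s' hs' => (e s' hs').trans (h s' hs'))
        fun ⟨x, i, h⟩ => ⟨x, i, fun s' hs' => by rw [e s' hs']; exact h s' hs'⟩

/-! ### Value iteration from above -/

/-- The value of the game with `n` steps. -/
noncomputable def horizonValue (n : ℕ) : Config L C → ℝ≥0∞ := G.bellman^[n] ⊤

theorem horizonValue_succ (n : ℕ) :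
    G.horizonValue (n + 1) = G.bellman (G.horizonValue n) :=
  Function.iterate_succ_apply' _ _ _

theorem horizonValue_antitone : Antitone G.horizonValue :=
  G.bellman_mono.antitone_iterate_of_map_le le_top

theorem horizonValue_simple [Finite C] (n : ℕ) : Simple G.T (G.horizonValue n) := by
  induction n with
  | zero => exact fun s _ => Or.inl fun _ _ => rfl
  | succ n ih => rw [horizonValue_succ]; exact G.bellman_simple ih

theorem exists_horizon [Finite L] [Finite C] :
    ∃ N, ∀ s ∈ G.T.S, G.bellman (G.horizonValue N) s = G.horizonValue N s := by
  obtain ⟨N, hN⟩ := exists_stationary G.horizonValue_antitone G.horizonValue_simple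
  exact ⟨N, fun s hs => by rw [← horizonValue_succ]; exact hN _ N.le_succ s hs⟩

/-- The optimality operator of the game in which every step costs `η` more. -/
noncomputable def costBellman (η : ℝ≥0∞) : (Config L C → ℝ≥0∞) →o (Config L C → ℝ≥0∞) where
  toFun f := G.bellman fun s => f s + η
  monotone' _ _ h := G.bellman_mono fun s => add_le_add_left (h s) _

/-- Unfolding the fixed point `n` times collects at most `n` surcharges; the base case is trivial
because iteration starts at `⊤`. -/
theorem gfp_costBellman_le (η : ℝ≥0∞) (n : ℕ) (s : Config L C) :
    (G.costBellman η).gfp s ≤ G.horizonValue n s + n * η := by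
  induction n generalizing s with
  | zero => simp [horizonValue]
  | succ n ih =>
    calc (G.costBellman η).gfp s = G.bellman (fun s => (G.costBellman η).gfp s + η) s :=
          congrFun (G.costBellman η).map_gfp.symm s
      _ ≤ G.bellman (fun s => G.horizonValue n s + (n * η + η)) s := by
          refine G.bellman_mono (fun s => ?_) s
          rw [← add_assoc]
          exact add_le_add_left (ih s) _
      _ ≤ G.bellman (G.horizonValue n) s + (n * η + η) := G.bellman_add_const_le _ _ _
      _ = G.horizonValue (n + 1) s + (n + 1 : ℕ) * η := by
          rw [horizonValue_succ]; push_cast; ring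

/-! ### Positional strategies from potential functions -/

variable {G}

/-- Elapsed time plus `W` never drops below its initial value before `F` is reached, and `W`
vanishes on `F`. Runs that miss `F` cost `∞` anyway. -/
theorem exists_maxStrategy {W : Config L C → ℝ≥0∞} (hF : ∀ s ∈ G.T.F, W s = 0)
    (hMin : ∀ s ∈ G.SMin, s ∉ G.T.F → ∀ τ, G.T.Legal s τ → W s ≤ τ.2 + W (G.T.succ s τ))
    (hMax : ∀ s ∈ G.SMax, s ∉ G.T.F → ∃ τ, G.T.Legal s τ ∧ W s ≤ τ.2 + W (G.T.succ s τ)) :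
    ∃ χ : G.MaxStrategy, χ.Positional ∧ ∀ s : G.T.S, W s ≤ χ.val s := by
  have : ∀ s : G.T.S, ∃ τ, G.T.Legal s τ ∧
      (s.1 ∈ G.SMax → s.1 ∉ G.T.F → W s ≤ τ.2 + W (G.T.succ s τ)) := by
    intro s
    by_cases h : s.1 ∈ G.SMax ∧ s.1 ∉ G.T.F
    · obtain ⟨τ, h1, h2⟩ := hMax s h.1 h.2
      exact ⟨τ, h1, fun _ _ => h2⟩
    · obtain ⟨a, ha⟩ := TimedAutomaton.exists_legal s.2
      exact ⟨_, ha, fun h1 h2 => absurd ⟨h1, h2⟩ h⟩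
  choose σ hσ hσW using this
  refine ⟨⟨fun r => σ ⟨r.last, r.last_mem⟩, fun r _ => hσ ⟨r.last, r.last_mem⟩⟩,
    fun r r' h => congrArg σ (Subtype.ext h), fun s => le_iInf fun μ => ?_⟩
  set χ : G.MaxStrategy := ⟨fun r => σ ⟨r.last, r.last_mem⟩, fun r _ => hσ ⟨r.last, r.last_mem⟩⟩
  have hstep : ∀ i, (run s μ χ).state i ∉ G.T.F →
      W ((run s μ χ).state i) ≤ ((run s μ χ).move i).2 + W ((run s μ χ).state (i + 1)) := by
    intro i hi
    have hl := choice_step μ χ (prefixRun s μ χ i)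
    by_cases h : (prefixRun s μ χ i).last ∈ G.SMin
    · exact hMin _ h hi _ hl
    · have e : choice μ χ (prefixRun s μ χ i) = χ.1 (prefixRun s μ χ i) := if_neg h
      have := hσW ⟨_, (prefixRun s μ χ i).last_mem⟩ ⟨(prefixRun s μ χ i).last_mem, h⟩ hi
      change _ ≤ ((choice μ χ (prefixRun s μ χ i)).2 : ℝ≥0∞) +
        W (G.T.succ (prefixRun s μ χ i).last (choice μ χ (prefixRun s μ χ i)))
      rw [e]
      exact this
  classical
  unfold InfRun.RT
  split_ifs with h
  · have hsum : ∀ i ≤ Nat.find h, W s ≤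
        ∑ j ∈ Finset.range i, (((run s μ χ).move j).2 : ℝ≥0∞) + W ((run s μ χ).state i) := by
      intro i
      induction i with
      | zero => intro _; simp [run, prefixRun, FinRun.last]
      | succ i ih =>
        intro hi
        refine (ih (Nat.le_of_succ_le hi)).trans ?_
        rw [Finset.sum_range_succ, add_assoc]
        exact add_le_add_right (hstep i (Nat.find_min h hi)) _
    have := hsum _ le_rfl
    rwa [hF _ (Nat.find_spec h), add_zero] at this
  · exact le_top

/-- Each step lowers `U` by its delay plus `η`. A finite `U s` thus bounds both the elapsed time and
the number of steps before `F`. -/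
theorem exists_minStrategy {U : Config L C → ℝ≥0∞} {η : ℝ≥0∞} (hη : η ≠ 0)
    (hMin : ∀ s ∈ G.SMin, s ∉ G.T.F → U s ≠ ⊤ →
      ∃ τ, G.T.Legal s τ ∧ τ.2 + (U (G.T.succ s τ) + η) ≤ U s)
    (hMax : ∀ s ∈ G.SMax, s ∉ G.T.F → ∀ τ, G.T.Legal s τ →
      τ.2 + (U (G.T.succ s τ) + η) ≤ U s) :
    ∃ μ : G.MinStrategy, μ.Positional ∧ ∀ s : G.T.S, μ.val s ≤ U s := by
  have : ∀ s : G.T.S, ∃ τ, G.T.Legal s τ ∧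
      (s.1 ∈ G.SMin → s.1 ∉ G.T.F → U s ≠ ⊤ → τ.2 + (U (G.T.succ s τ) + η) ≤ U s) := by
    intro s
    by_cases h : s.1 ∈ G.SMin ∧ s.1 ∉ G.T.F ∧ U s ≠ ⊤
    · obtain ⟨τ, h1, h2⟩ := hMin s h.1 h.2.1 h.2.2
      exact ⟨τ, h1, fun _ _ _ => h2⟩
    · obtain ⟨a, ha⟩ := TimedAutomaton.exists_legal s.2
      exact ⟨_, ha, fun h1 h2 h3 => absurd ⟨h1, h2, h3⟩ h⟩
  choose σ hσ hσU using this
  refine ⟨⟨fun r => σ ⟨r.last, r.last_mem⟩, fun r _ => hσ ⟨r.last, r.last_mem⟩⟩,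
    fun r r' h => congrArg σ (Subtype.ext h), fun s => iSup_le fun χ => ?_⟩
  set μ : G.MinStrategy := ⟨fun r => σ ⟨r.last, r.last_mem⟩, fun r _ => hσ ⟨r.last, r.last_mem⟩⟩
  by_cases hs : U s = ⊤
  · simp [hs]
  have hstep : ∀ i, (run s μ χ).state i ∉ G.T.F → U ((run s μ χ).state i) ≠ ⊤ →
      ((run s μ χ).move i).2 + (U ((run s μ χ).state (i + 1)) + η) ≤
        U ((run s μ χ).state i) := by
    intro i hi hU
    have hl := choice_step μ χ (prefixRun s μ χ i)
    by_cases h : (prefixRun s μ χ i).last ∈ G.SMin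
    · have e : choice μ χ (prefixRun s μ χ i) = μ.1 (prefixRun s μ χ i) := if_pos h
      have := hσU ⟨_, (prefixRun s μ χ i).last_mem⟩ h hi hU
      change ((choice μ χ (prefixRun s μ χ i)).2 : ℝ≥0∞) +
        (U (G.T.succ (prefixRun s μ χ i).last (choice μ χ (prefixRun s μ χ i))) + η) ≤ _
      rw [e]
      exact this
    · exact hMax _ ⟨(prefixRun s μ χ i).last_mem, h⟩ hi _ hl
  have hsum : ∀ i, (∀ j < i, (run s μ χ).state j ∉ G.T.F) →
      ∑ j ∈ Finset.range i, (((run s μ χ).move j).2 : ℝ≥0∞) +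
        (U ((run s μ χ).state i) + i * η) ≤ U s := by
    intro i
    induction i with
    | zero => intro _; simp [run, prefixRun, FinRun.last]
    | succ i ih =>
      intro hi
      have h1 := ih fun j hj => hi j (hj.trans i.lt_succ_self)
      have hU : U ((run s μ χ).state i) ≠ ⊤ :=
        ne_top_of_le_ne_top hs ((le_self_add.trans le_add_self).trans h1)
      refine le_trans ?_ h1
      rw [Finset.sum_range_succ, add_assoc]
      refine add_le_add_right ?_ _
      calc _ = (((run s μ χ).move i).2 + (U ((run s μ χ).state (i + 1)) + η)) + i * η := by
            push_cast; ring
        _ ≤ _ := add_le_add_left (hstep i (hi i i.lt_succ_self) hU) _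
  classical
  unfold InfRun.RT
  split_ifs with h
  · exact le_self_add.trans (hsum _ fun j hj => Nat.find_min h hj)
  · push Not at h
    obtain ⟨n, hn⟩ := ENNReal.exists_nat_mul_gt hη hs
    exact absurd ((le_add_self.trans le_add_self).trans (hsum n fun j _ => h j)) (not_le.2 hn)

/-! ### Near-optimal positional strategies -/

theorem bellman_of_mem_SMin (f : Config L C → ℝ≥0∞) {s : Config L C} (hs : s ∈ G.SMin)
    (hF : s ∉ G.T.F) : G.bellman f s = infStep G.T f s := by
  simp [bellman, hF, hs.2]

theorem bellman_of_mem_SMax (f : Config L C → ℝ≥0∞) {s : Config L C} (hs : s ∈ G.SMax)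
    (hF : s ∉ G.T.F) : G.bellman f s = supStep G.T f s := by
  have : s.1 ∉ G.LMin := fun h => hs.2 ⟨hs.1, h⟩
  simp [bellman, hF, this]

theorem bellman_of_mem_F (f : Config L C → ℝ≥0∞) {s : Config L C} (hF : s ∈ G.T.F) :
    G.bellman f s = 0 := by
  simp [bellman, hF]

theorem exists_minStrategy_le (n : ℕ) {ε : ℝ≥0} (hε : 0 < ε) :
    ∃ μ : G.MinStrategy, μ.Positional ∧ ∀ s : G.T.S, μ.val s ≤ G.horizonValue n s + ε := by
  -- Then `n * η ≤ ε`, and `n + 1` avoids division by zero when `n = 0`.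
  set η : ℝ≥0 := ε / (n + 1)
  have hη : 0 < η := by positivity
  have hη2 : 0 < η / 2 := by positivity
  set U := (G.costBellman η).gfp
  have hU : G.bellman (fun s => U s + η) = U := (G.costBellman η).map_gfp
  have hhalf : ((η / 2 : ℝ≥0) : ℝ≥0∞) + (η / 2 : ℝ≥0) = η := by
    rw [← ENNReal.coe_add, add_halves]
  suffices h : ∃ μ : G.MinStrategy, μ.Positional ∧ ∀ s : G.T.S, μ.val s ≤ U s by
    obtain ⟨μ, hμ, hμU⟩ := h
    refine ⟨μ, hμ, fun s => (hμU s).trans ((G.gfp_costBellman_le η n s).trans ?_)⟩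
    refine add_le_add_right ?_ _
    have : (n : ℝ≥0) * η ≤ ε := by
      calc (n : ℝ≥0) * η ≤ (n + 1) * η := by gcongr; simp
        _ = ε := by simp only [η]; field_simp
    exact_mod_cast this
  refine exists_minStrategy (η := (η / 2 : ℝ≥0)) (by exact_mod_cast hη2.ne')
    (fun s hs hF hfin => ?_) fun s hs hF τ hl => ?_
  · have e : infStep G.T (fun s => U s + η) s = U s := by
      rw [← bellman_of_mem_SMin _ hs hF, hU]
    -- One half of `η` is spent on missing the infimum; the other half remains as guaranteed
    -- progress.
    have hlt : infStep G.T (fun s => U s + η) s < U s + (η / 2 : ℝ≥0) := by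
      rw [e]
      exact ENNReal.lt_add_right hfin (by exact_mod_cast hη2.ne')
    obtain ⟨⟨τ, hl⟩, hτ⟩ := iInf_lt_iff.1 hlt
    refine ⟨τ, hl, ?_⟩
    rw [← hhalf, ← add_assoc, ← add_assoc] at hτ
    rw [← add_assoc]
    exact (ENNReal.add_le_add_iff_right ENNReal.coe_ne_top).1 hτ.le
  · have e : supStep G.T (fun s => U s + η) s = U s := by
      rw [← bellman_of_mem_SMax _ hs hF, hU]
    rw [← e]
    refine le_trans ?_ (le_supStep hl)
    gcongr
    exact half_le_self (by positivity)

variable {V : Config L C → ℝ≥0∞}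

theorem le_of_bellman_eq (hV : ∀ s ∈ G.T.S, G.bellman V s = V s) {s : Config L C}
    (hs : s ∈ G.SMin) (hF : s ∉ G.T.F) {τ : A × ℝ≥0} (hl : G.T.Legal s τ) :
    V s ≤ τ.2 + V (G.T.succ s τ) := by
  rw [← hV s hs.1, bellman_of_mem_SMin _ hs hF]
  exact infStep_le hl

theorem exists_maxStrategy_le [Finite L] [Finite C] [Nonempty C]
    (hV : ∀ s ∈ G.T.S, G.bellman V s = V s) (hsimple : Simple G.T V) {ε : ℝ≥0} (hε : 0 < ε) :
    ∃ χ : G.MaxStrategy, χ.Positional ∧ ∀ s : G.T.S, V s ≤ χ.val s + ε := by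
  obtain ⟨M, hM⟩ := hsimple.exists_bound
  -- The bound `1 / 2` keeps `r` positive, so that infinite values survive the discount; `ε / (M +
  -- 1)` makes its effect on finite values at most `ε`.
  obtain ⟨r, δ, hr, hr0, hδ, hδM⟩ : ∃ r δ : ℝ≥0, r + δ = 1 ∧ 0 < r ∧ 0 < δ ∧ δ * M ≤ ε := by
    refine ⟨1 - min (1 / 2) (ε / (M + 1)), min (1 / 2) (ε / (M + 1)), ?_, ?_, ?_, ?_⟩
    · exact tsub_add_cancel_of_le ((min_le_left _ _).trans (by norm_num))
    · exact tsub_pos_of_lt ((min_le_left _ _).trans_lt (by norm_num))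
    · exact lt_min (by norm_num) (by positivity)
    · calc min (1 / 2) (ε / (M + 1)) * M ≤ ε / (M + 1) * (M + 1) := by
            gcongr
            · exact min_le_right _ _
            · simp
        _ = ε := by field_simp
  have hr' : (r : ℝ≥0∞) + δ = 1 := by exact_mod_cast hr
  suffices h : ∃ χ : G.MaxStrategy, χ.Positional ∧ ∀ s : G.T.S, r * V s ≤ χ.val s by
    obtain ⟨χ, hχ, hχV⟩ := h
    refine ⟨χ, hχ, fun s => ?_⟩
    refine le_trans ?_ (add_le_add_left (hχV s) _)
    by_cases htop : V s = ⊤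
    · simp [htop, hr0.ne']
    · calc V s = r * V s + δ * V s := by rw [← add_mul, hr', one_mul]
        _ ≤ r * V s + δ * M := by gcongr; exact hM s s.2 htop
        _ ≤ _ := by gcongr; exact_mod_cast hδM
  refine exists_maxStrategy (W := fun s => r * V s) (fun s hF => ?_)
    (fun s hs hF τ hl => ?_) fun s hs hF => ?_
  · simp [← hV s (G.T.F_subset hF), bellman_of_mem_F _ hF]
  · calc (r : ℝ≥0∞) * V s ≤ r * (τ.2 + V (G.T.succ s τ)) := by
          gcongr; exact le_of_bellman_eq hV hs hF hl
      _ = r * τ.2 + r * V (G.T.succ s τ) := mul_add _ _ _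
      _ ≤ _ := by
          gcongr
          exact mul_le_of_le_one_left' (hr' ▸ le_self_add)
  · have e : supStep G.T V s = V s := by
      rw [← bellman_of_mem_SMax _ hs hF, hV s hs.1]
    by_cases htop : supStep G.T V s = ⊤
    · obtain ⟨τ, hl, hτ⟩ := hsimple.exists_legal_eq_top hs.1 htop
      exact ⟨τ, hl, by simp [hτ, hr0.ne']⟩
    · obtain ⟨τ, hl, hτ⟩ := hsimple.exists_legal_mul_le hs.1 htop hr hδ
      exact ⟨τ, hl, by rwa [e] at hτ⟩

/-- Without clocks waiting changes nothing, so waiting for `t` in every nonfinal state of Max is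
legal and secures `t` at once. -/
theorem exists_maxStrategy_min_le [IsEmpty C] (hV : ∀ s ∈ G.T.S, G.bellman V s = V s) (t : ℝ≥0) :
    ∃ χ : G.MaxStrategy, χ.Positional ∧ ∀ s : G.T.S, min (V s) t ≤ χ.val s := by
  refine exists_maxStrategy (W := fun s => min (V s) t) (fun s hF => ?_)
    (fun s hs hF τ hl => ?_) fun s hs hF => ?_
  · simp [← hV s (G.T.F_subset hF), bellman_of_mem_F _ hF]
  · rw [add_min]
    exact min_le_min (le_of_bellman_eq hV hs hF hl) le_add_self
  · obtain ⟨a, ha⟩ := exists_legal_of_isEmpty hs.1 t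
    exact ⟨_, ha, (min_le_right _ _).trans le_self_add⟩

/-! ### Comparison of the values -/

theorem le_iSup_positional [Finite L] [Finite C] (hV : ∀ s ∈ G.T.S, G.bellman V s = V s)
    (hsimple : Simple G.T V) (s : G.T.S) :
    V s ≤ ⨆ χ : {χ : G.MaxStrategy // χ.Positional}, χ.1.val s := by
  rcases isEmpty_or_nonempty C with hC | hC
  · refine le_of_forall_lt fun c hc => ?_
    obtain ⟨d, hd1, hd2⟩ := ENNReal.lt_iff_exists_nnreal_btwn.1 hc
    obtain ⟨χ, hχ, hχV⟩ := exists_maxStrategy_min_le hV d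
    have := hχV s
    rw [min_eq_right hd2.le] at this
    exact hd1.trans_le (this.trans (le_iSup
      (fun χ : {χ : G.MaxStrategy // χ.Positional} => χ.1.val s) ⟨χ, hχ⟩))
  · refine ENNReal.le_of_forall_pos_le_add fun ε hε _ => ?_
    obtain ⟨χ, hχ, hχV⟩ := exists_maxStrategy_le hV hsimple hε
    exact (hχV s).trans (add_le_add_left (le_iSup
      (fun χ : {χ : G.MaxStrategy // χ.Positional} => χ.1.val s) ⟨χ, hχ⟩) _)

theorem iInf_positional_le (n : ℕ) (s : G.T.S) :
    ⨅ μ : {μ : G.MinStrategy // μ.Positional}, μ.1.val s ≤ G.horizonValue n s := by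
  refine ENNReal.le_of_forall_pos_le_add fun ε hε _ => ?_
  obtain ⟨μ, hμ, hμV⟩ := exists_minStrategy_le (G := G) n hε
  exact (iInf_le (fun μ : {μ : G.MinStrategy // μ.Positional} => μ.1.val s) ⟨μ, hμ⟩).trans (hμV s)

theorem iSup_positional_le_lowerValue (s : G.T.S) :
    ⨆ χ : {χ : G.MaxStrategy // χ.Positional}, χ.1.val s ≤ G.lowerValue s :=
  iSup_le fun χ => le_iSup (fun χ : G.MaxStrategy => χ.val s) χ.1

theorem upperValue_le_iInf_positional (s : G.T.S) :
    G.upperValue s ≤ ⨅ μ : {μ : G.MinStrategy // μ.Positional}, μ.1.val s :=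
  le_iInf fun μ => iInf_le (fun μ : G.MinStrategy => μ.val s) μ.1

theorem lowerValue_le_upperValue (s : G.T.S) : G.lowerValue s ≤ G.upperValue s :=
  iSup_iInf_le_iInf_iSup _

end Game

end ReachTime

open ReachTime ReachTime.Game in
theorem mainTheorem1 {L C A : Type*} [Finite L] [Finite C] [Finite A] {k : ℕ}
    (G : ReachTime.Game L C A k) :
    G.PositionallyDetermined ∧
      ∀ ε : ℝ≥0, 0 < ε →
        (∃ μ : G.MinStrategy, μ.Positional ∧ μ.EpsOptimal ε) ∧
        (Nonempty C → ∃ χ : G.MaxStrategy, χ.Positional ∧ χ.EpsOptimal ε) := by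
  obtain ⟨N, hN⟩ := G.exists_horizon
  have hsimple := G.horizonValue_simple N
  have a := fun s => le_iSup_positional hN hsimple s
  have b := fun s => iSup_positional_le_lowerValue (G := G) s
  have c := fun s => lowerValue_le_upperValue (G := G) s
  have d := fun s => upperValue_le_iInf_positional (G := G) s
  have e := fun s => iInf_positional_le (G := G) N s
  -- The inequalities `a` to `e` form a cycle from `G.horizonValue N s` to itself, so all five
  -- quantities coincide.
  have hlow : ∀ s : G.T.S, G.lowerValue s = G.horizonValue N s := fun s =>
    le_antisymm ((c s).trans ((d s).trans (e s))) ((a s).trans (b s))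
  refine ⟨fun s => ⟨G.horizonValue N s, ⟨hlow s, le_antisymm ((d s).trans (e s))
    ((hlow s).ge.trans (c s))⟩, ?_, ?_⟩, fun ε hε => ⟨?_, fun hC => ?_⟩⟩
  · exact le_antisymm ((hlow s).ge.trans ((c s).trans (d s))) (e s)
  · exact le_antisymm (a s) ((b s).trans (hlow s).le)
  · obtain ⟨μ, hμ, hμV⟩ := exists_minStrategy_le (G := G) N hε
    refine ⟨μ, hμ, fun s v hv => ?_⟩
    rw [← hv.1, hlow s]
    exact hμV s
  · obtain ⟨χ, hχ, hχV⟩ := exists_maxStrategy_le hN hsimple hε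
    refine ⟨χ, hχ, fun s v hv => ?_⟩
    rw [← hv.1, hlow s]
    exact hχV s
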